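/- Let $\mu_\pm>0$ and $\nu_\pm$ be the shear moduli and Poisson ratios of the elastic half-spaces $\pm x_2>0$, and put $$b=\frac{1-\nu_+}{\mu_+}+\frac{1-\nu_-}{\mu_-},\qquad e=\frac{\nu_+}{\mu_+}+\frac{\nu_-}{\mu_-},\qquad \eta=\frac{\mu_--\mu_+}{\mu_-+\mu_+}.$$ For a function $f(x_1,x_2)$ write $f(x_1,0^\pm)$ for its limit at $(x_1,0)$ from the half-plane $\pm x_2>0$, $[\![f]\!](x_1)=f(x_1,0^+)-f(x_1,0^-)$, $\langle f\rangle(x_1)=\tfrac12\big(f(x_1,0^+)+f(x_1,0^-)\big)$; $f^{(\pm)}$ denotes the restriction of a function of $x_1$ to $\pm x_1>0$, extended by zero. Let $u_3(x_1,x_2)$ be the displacement of an antiplane deformation with a crack $\{x_1<0,\ x_2=0\}$: with $\sigma_{13}=\mu_\pm\,\partial u_3/\partial x_1$ and $\sigma_{23}=\mu_\pm\,\partial u_3/\partial x_2$ for $\pm x_2>0$, 1. $u_3$ is $C^2$ and $\partial\sigma_{13}/\partial x_1+\partial\sigma_{23}/\partial x_2=0$ in both open half-planes; 2. there is a finite set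 $E\subset(-\infty,0)$ such that $u_3,\sigma_{13},\sigma_{23}$ have finite limits at $(x_1,0)$ from both half-planes for all $x_1\in\mathbb R\setminus(E\cup\{0\})$; 3. (perfect contact) $[\![u_3]\!](x_1)=[\![\sigma_{23}]\!](x_1)=0$ for $x_1>0$; 4. (loading of the crack faces) $\sigma_{23}(x_1,0^\pm)=p_{3\pm}(x_1)$ for $x_1<0$, $x_1\notin E$; put $\langle p_3\rangle=\tfrac12(p_{3+}+p_{3-})$ and $[\![p_3]\!]=p_{3+}-p_{3-}$; 5. (decay) there is $M:\mathbb R\to\mathbb R$ with $\int_{\mathbb R}\frac{|M(x_1)|}{1+|x_1|}\,dx_1<\infty$ and $|\sigma_{13}(x_1,x_2)|,|\sigma_{23}(x_1,x_2)|\le M(x_1)$ for all $x_2\ne0$ and $x_1\notin E\cup\{0\}$ (this holds, for instance, if the stresses are $O(r^{-\delta})$ at infinity for some $\delta>0$ and $O(r^{-\alpha})$ for some $\alpha<1$ near the crack tip and near the points of $E$, $r$ being the distance to the point in question). Let $\mathcal S\varphi(x_1)=\frac1\pi\,\mathrm{p.v.}\!\int_{-\infty}^{\infty}\frac{\varphi(\xi)}{x_1-\xi}\,d\xi$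 be the Cauchy singular operator, let $\mathcal P_\pm$ be the projectors given by restriction to $\pm x_1\ge0$ and extension by zero, and put $\mathcal S^{(s)}=\mathcal P_-\mathcal S\mathcal P_-$ and $\mathcal S^{(c)}=\mathcal P_+\mathcal S\mathcal P_-$. Then $[\![u_3]\!]^{(-)}$ is differentiable at every $x_1\notin E\cup\{0\}$; for every $x_1<0$ with $x_1\notin E$ the principal value below exists and $$\langle p_3\rangle+\frac{\eta}{2}[\![p_3]\!]=-\frac1{b+e}\,\mathcal S^{(s)}\frac{\partial[\![u_3]\!]^{(-)}}{\partial x_1};$$ and for every $x_1>0$ the integral $\int_{-\infty}^0\frac{1}{x_1-\xi}\frac{\partial[\![u_3]\!]^{(-)}}{\partial\xi}\,d\xi$ converges absolutely and $$\langle\sigma_{23}\rangle^{(+)}=-\frac1{b+e}\,\mathcal S^{(c)}\frac{\partial[\![u_3]\!]^{(-)}}{\partial x_1}.$$ -/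

import Mathlib

open Set Filter Topology MeasureTheory

noncomputable section

namespace InterfacialCrack

/-! ### Bimaterial constants -/

/-- The constant `b` (shear moduli `μp, μm`, Poisson ratios `νp, νm` above and below). -/
def bConst (μp μm νp νm : ℝ) : ℝ := (1 - νp) / μp + (1 - νm) / μm

/-- The constant `e`. -/
def eConst (μp μm νp νm : ℝ) : ℝ := νp / μp + νm / μm

/-- The constant `η`. -/
def etaConst (μp μm : ℝ) : ℝ := (μm - μp) / (μm + μp)

/-! ### Limits at the plane of the crack, jumps and averages

A point of the plane of deformation is `(x₁, x₂) : ℝ × ℝ`. -/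

/-- The open upper half-plane `x₂ > 0`. -/
def upperHalf : Set (ℝ × ℝ) := {z | 0 < z.2}

/-- The open lower half-plane `x₂ < 0`. -/
def lowerHalf : Set (ℝ × ℝ) := {z | z.2 < 0}

/-- `f` has finite limits at `(x, 0)` from the upper and from the lower half-plane. -/
def HasTraces (f : ℝ × ℝ → ℝ) (x : ℝ) : Prop :=
  (∃ l, Tendsto f (𝓝[upperHalf] (x, 0)) (𝓝 l)) ∧ (∃ l, Tendsto f (𝓝[lowerHalf] (x, 0)) (𝓝 l))

/-- `f(x, 0⁺)`. -/
def traceUp (f : ℝ × ℝ → ℝ) (x : ℝ) : ℝ := limUnder (𝓝[upperHalf] (x, 0)) f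

/-- `f(x, 0⁻)`. -/
def traceDown (f : ℝ × ℝ → ℝ) (x : ℝ) : ℝ := limUnder (𝓝[lowerHalf] (x, 0)) f

/-- The jump of `f` across `x₂ = 0`. -/
def jump (f : ℝ × ℝ → ℝ) (x : ℝ) : ℝ := traceUp f x - traceDown f x

/-- The average of `f` across `x₂ = 0`. -/
def average (f : ℝ × ℝ → ℝ) (x : ℝ) : ℝ := (traceUp f x + traceDown f x) / 2

/-- `f⁽⁺⁾`, the restriction of `f` to the positive half-axis, extended by zero. -/
def plusPart (f : ℝ → ℝ) : ℝ → ℝ := (Ioi 0).indicator f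

/-- `f⁽⁻⁾`, the restriction of `f` to the negative half-axis, extended by zero. -/
def minusPart (f : ℝ → ℝ) : ℝ → ℝ := (Iio 0).indicator f

/-! ### Antiplane deformation of a bimaterial plane with a crack `x₁ < 0, x₂ = 0` -/

/-- Shear modulus at height `x₂`. -/
def shearModulus (μp μm : ℝ) (x₂ : ℝ) : ℝ := if 0 < x₂ then μp else μm

/-- The stress component `σ₁₃ = μ ∂u₃/∂x₁`. -/
def stress13 (μp μm : ℝ) (u : ℝ × ℝ → ℝ) (z : ℝ × ℝ) : ℝ :=
  shearModulus μp μm z.2 * deriv (fun t => u (t, z.2)) z.1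

/-- The stress component `σ₂₃ = μ ∂u₃/∂x₂`. -/
def stress23 (μp μm : ℝ) (u : ℝ × ℝ → ℝ) (z : ℝ × ℝ) : ℝ :=
  shearModulus μp μm z.2 * deriv (fun t => u (z.1, t)) z.2

/-- `u` is the out-of-plane displacement `u₃` of an antiplane deformation of two bonded half-planes
with shear moduli `μp` (above) and `μm` (below) and with a crack along `x₁ < 0`, `x₂ = 0`, whose
upper and lower faces carry the tractions `σ₂₃ = pp` and `σ₂₃ = pm`. Displacement and stresses are
continuous up to both sides of the line `x₂ = 0` except perhaps at the crack tip `x₁ = 0` and at the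
points `x₁ ∈ E` (where the loading may be discontinuous or singular). -/
structure IsAntiplaneCrackField (μp μm : ℝ) (pp pm : ℝ → ℝ) (E : Set ℝ)
    (u : ℝ × ℝ → ℝ) : Prop where
  /-- The displacement is twice continuously differentiable in both open half-planes. -/
  smooth : ContDiffOn ℝ 2 u (upperHalf ∪ lowerHalf)
  /-- Equilibrium without body forces: `∂σ₁₃/∂x₁ + ∂σ₂₃/∂x₂ = 0`. -/
  equilibrium : ∀ z ∈ upperHalf ∪ lowerHalf,
    deriv (fun t => stress13 μp μm u (t, z.2)) z.1 +
      deriv (fun t => stress23 μp μm u (z.1, t)) z.2 = 0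
  trace_displacement : ∀ x, x ≠ 0 → x ∉ E → HasTraces u x
  trace_stress13 : ∀ x, x ≠ 0 → x ∉ E → HasTraces (stress13 μp μm u) x
  trace_stress23 : ∀ x, x ≠ 0 → x ∉ E → HasTraces (stress23 μp μm u) x
  /-- Perfect contact ahead of the crack: continuity of the displacement. -/
  contact_displacement : ∀ x, 0 < x → jump u x = 0
  /-- Perfect contact ahead of the crack: continuity of the traction. -/
  contact_traction : ∀ x, 0 < x → jump (stress23 μp μm u) x = 0
  /-- Prescribed traction on the upper crack face. -/
  load_up : ∀ x, x < 0 → x ∉ E → traceUp (stress23 μp μm u) x = pp x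
  /-- Prescribed traction on the lower crack face. -/
  load_down : ∀ x, x < 0 → x ∉ E → traceDown (stress23 μp μm u) x = pm x
  /-- Decay at infinity and integrable singularities: the suprema of the stresses over vertical
  lines are dominated by a function that is integrable with respect to `dx₁ / (1 + |x₁|)`. -/
  decay : ∃ M : ℝ → ℝ, Integrable (fun x => M x / (1 + |x|)) ∧
    ∀ x y, x ≠ 0 → x ∉ E → y ≠ 0 →
      |stress13 μp μm u (x, y)| ≤ M x ∧ |stress23 μp μm u (x, y)| ≤ M x

/-! ### The Cauchy singular operator -/

/-- The integral `(1/π) ∫ φ(ξ) / (x - ξ) dξ` over `|x - ξ| > ε`. -/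
def truncatedCauchy (φ : ℝ → ℝ) (x ε : ℝ) : ℝ :=
  1 / Real.pi * ∫ ξ in {ξ | ε < |x - ξ|}, φ ξ / (x - ξ)

/-- The integral `(1/π) ∫ φ(ξ) / (x - ξ) dξ` exists as a Cauchy principal value. -/
def CauchyPVExists (φ : ℝ → ℝ) (x : ℝ) : Prop :=
  (∀ ε, 0 < ε → IntegrableOn (fun ξ => φ ξ / (x - ξ)) {ξ | ε < |x - ξ|}) ∧
    ∃ v, Tendsto (truncatedCauchy φ x) (𝓝[>] 0) (𝓝 v)

/-- The Cauchy singular operator `S φ (x) = (1/π) p.v. ∫ φ(ξ) / (x - ξ) dξ`. -/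
def cauchyS (φ : ℝ → ℝ) (x : ℝ) : ℝ := limUnder (𝓝[>] 0) (truncatedCauchy φ x)

/-- The projector `P₊` onto functions supported on `x ≥ 0`. -/
def projPlus (φ : ℝ → ℝ) : ℝ → ℝ := (Ici 0).indicator φ

/-- The projector `P₋` onto functions supported on `x ≤ 0`. -/
def projMinus (φ : ℝ → ℝ) : ℝ → ℝ := (Iic 0).indicator φ

/-- The singular operator `S⁽ˢ⁾ = P₋ S P₋`. -/
def opS (φ : ℝ → ℝ) : ℝ → ℝ := projMinus (cauchyS (projMinus φ))

/-- The operator `S⁽ᶜ⁾ = P₊ S P₋`, whose only singularity is the fixed point `0`. -/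
def opC (φ : ℝ → ℝ) : ℝ → ℝ := projPlus (cauchyS (projMinus φ))

end InterfacialCrack

end

/-!
In each half-plane `u` is harmonic, so the complex gradient `F = ∂u/∂x₁ - i ∂u/∂x₂` is holomorphic
there (for the lower half-plane, after the reflection `x₂ ↦ -x₂`, which changes the sign of
`∂u/∂x₂`). By the decay condition `|F(x + iy)|` is at most a multiple of `M x` for all heights `y`,
where `M x / (1 + |x|)` is integrable.

Such a function satisfies Cauchy's theorem for `F z / (z - x₀)` on horizontal lines with no
contribution from infinity (`IsDominatedHolomorphic.integral_cauchyQuotient_eq_zero`): the vertical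
integral `i ∫ F / (z - x₀) dy` over a segment of a strip is, as a function of the abscissa,
integrable with an integrable derivative, so it tends to zero. Domination uniform in the height lets
the line be pushed down to the boundary, except over `(x₀ - ε, x₀ + ε)`, where it runs along the
upper three sides of a rectangle (`IsDominatedHolomorphic.integral_boundary_div_eq`). If `F` is
continuous up to `x₀`, the integral over these sides tends to minus `πi` times the boundary value
at `x₀`. Hence the principal value exists at every such point, and no regularity of `F` at the
boundary beyond continuity is needed (`IsDominatedHolomorphic.tendsto_integral_boundary_div`). Its
real part says that on the boundary `∂u/∂x₂ = -S ∂u/∂x₁` from above and `∂u/∂x₂ = S ∂u/∂x₁` from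
below (`IsDominatedHarmonic.tendsto_truncatedCauchy`).

The displacement on either face is differentiable with the boundary value of `∂u/∂x₁` as its
derivative (`IsDominatedHarmonic.hasDerivAt_trace`), and the jump of `u` vanishes ahead of the
crack. Subtracting the two relations therefore gives `σ₂₃⁺ / μ₊ + σ₂₃⁻ / μ₋ = -S (∂⟦u⟧⁽⁻⁾/∂x₁)`, and
`b + e = 1 / μ₊ + 1 / μ₋` turns this into both identities.
-/

namespace InterfacialCrack

/-! ### Holomorphic functions dominated on vertical lines -/

/-- `F` is holomorphic in the upper half-plane, has the boundary values `f` off the finite set `S`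
of the real line, and is dominated on vertical lines (over points off `S`) by a function `M` that
is integrable with respect to `dx / (1 + |x|)`. -/
structure IsDominatedHolomorphic (F : ℂ → ℂ) (f : ℝ → ℂ) (M : ℝ → ℝ) (S : Set ℝ) : Prop where
  differentiableOn : DifferentiableOn ℂ F {z | 0 < z.im}
  finite : S.Finite
  integrable : Integrable fun x => M x / (1 + |x|)
  bound : ∀ x y : ℝ, x ∉ S → 0 < y → ‖F (x + y * Complex.I)‖ ≤ M x
  trace : ∀ x, x ∉ S → Tendsto F (𝓝[{z | 0 < z.im}] (x : ℂ)) (𝓝 (f x))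

theorem ae_notMem_of_finite {S : Set ℝ} (hS : S.Finite) : ∀ᵐ x : ℝ, x ∉ S :=
  measure_eq_zero_iff_ae_notMem.1 (hS.measure_zero _)

/-! ### Cauchy's theorem in horizontal strips -/

section Strip

variable {G : ℂ → ℂ} {δ H : ℝ}

theorem continuous_horizontal (hG : ContinuousOn G {z | 0 < z.im}) (hδ : 0 < δ) :
    Continuous fun x : ℝ => G (x + δ * Complex.I) :=
  hG.comp_continuous (by fun_prop) fun x => by simpa using hδ

theorem continuousOn_vertical (hG : ContinuousOn G {z | 0 < z.im}) (x : ℝ) :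
    ContinuousOn (fun y : ℝ => G (x + y * Complex.I)) (Ioi 0) :=
  hG.comp (by fun_prop) fun y hy => by simpa using hy

/-- By Cauchy's theorem for rectangles, the integral of a holomorphic function over a vertical
segment has the difference of the horizontal boundary values as its derivative with respect to the
abscissa. -/
theorem hasDerivAt_vertical_integral (hG : DifferentiableOn ℂ G {z | 0 < z.im}) (hδ : 0 < δ)
    (hH : 0 < H) (x : ℝ) :
    HasDerivAt (fun x : ℝ => Complex.I * ∫ y in δ..H, G (x + y * Complex.I))
      (G (x + H * Complex.I) - G (x + δ * Complex.I)) x := by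
  have hc₁ := continuous_horizontal hG.continuousOn hδ
  have hc₂ := continuous_horizontal hG.continuousOn hH
  -- the rectangle with opposite corners `iδ` and `x + iH`
  have key : (fun x : ℝ => Complex.I * ∫ y in δ..H, G (x + y * Complex.I)) = fun x : ℝ =>
      (Complex.I * ∫ y in δ..H, G ((0 : ℝ) + y * Complex.I)) +
        ((∫ t in (0 : ℝ)..x, G (t + H * Complex.I)) -
          ∫ t in (0 : ℝ)..x, G (t + δ * Complex.I)) := by
    funext x
    have h := Complex.integral_boundary_rect_eq_zero_of_differentiableOn G
      ⟨0, δ⟩ ⟨x, H⟩ (hG.mono fun z hz => ?_)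
    · simp only [smul_eq_mul] at h
      linear_combination h
    · have h2 := hz.2
      simp only [mem_preimage, uIcc, mem_Icc] at h2
      exact lt_of_lt_of_le (lt_min hδ hH) h2.1
  rw [key]
  exact (((hc₂.integral_hasStrictDerivAt 0 x).hasDerivAt).sub
    ((hc₁.integral_hasStrictDerivAt 0 x).hasDerivAt)).const_add _

variable {K : ℝ → ℝ} {S : Set ℝ}

theorem integrable_horizontal (hG : ContinuousOn G {z | 0 < z.im}) (hS : S.Finite)
    (hK : Integrable K) (hδ : 0 < δ)
    (hb : ∀ x : ℝ, x ∉ S → ‖G (x + δ * Complex.I)‖ ≤ K x) :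
    Integrable fun x : ℝ => G (x + δ * Complex.I) := by
  refine hK.mono' (continuous_horizontal hG hδ).aestronglyMeasurable ?_
  filter_upwards [ae_notMem_of_finite hS] with x hx using hb x hx

theorem integrable_vertical_integral (hG : DifferentiableOn ℂ G {z | 0 < z.im}) (hS : S.Finite)
    (hK : Integrable K) (hδ : 0 < δ) (hδH : δ ≤ H)
    (hb : ∀ x y : ℝ, x ∉ S → δ ≤ y → ‖G (x + y * Complex.I)‖ ≤ K x) :
    Integrable fun x : ℝ => Complex.I * ∫ y in δ..H, G (x + y * Complex.I) := by
  have hcont : Continuous fun x : ℝ => Complex.I * ∫ y in δ..H, G (x + y * Complex.I) :=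
    continuous_iff_continuousAt.2 fun x =>
      (hasDerivAt_vertical_integral hG hδ (hδ.trans_le hδH) x).continuousAt
  refine (hK.mul_const |H - δ|).mono' hcont.aestronglyMeasurable ?_
  filter_upwards [ae_notMem_of_finite hS] with x hx
  rw [norm_mul, Complex.norm_I, one_mul]
  refine intervalIntegral.norm_integral_le_of_norm_le_const fun y hy => hb x y hx ?_
  rw [uIoc_of_le hδH] at hy
  exact hy.1.le

/-- The integral over a horizontal line does not depend on the height. -/
theorem integral_horizontal_eq (hG : DifferentiableOn ℂ G {z | 0 < z.im}) (hS : S.Finite)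
    (hK : Integrable K) (hδ : 0 < δ) (hδH : δ ≤ H)
    (hb : ∀ x y : ℝ, x ∉ S → δ ≤ y → ‖G (x + y * Complex.I)‖ ≤ K x) :
    ∫ x : ℝ, G (x + H * Complex.I) = ∫ x : ℝ, G (x + δ * Complex.I) := by
  have h₁ := integrable_horizontal hG.continuousOn hS hK hδ fun x hx => hb x δ hx le_rfl
  have h₂ := integrable_horizontal hG.continuousOn hS hK (hδ.trans_le hδH)
    fun x hx => hb x H hx hδH
  rw [← sub_eq_zero, ← integral_sub h₂ h₁]
  exact integral_eq_zero_of_hasDerivAt_of_integrable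
    (hasDerivAt_vertical_integral hG hδ (hδ.trans_le hδH)) (h₂.sub h₁)
    (integrable_vertical_integral hG hS hK hδ hδH hb)

/-- Cauchy's theorem for two half-strips `x < a` and `x > b` between the heights `δ` and `H`. -/
theorem integral_horizontal_Iio_union_Ioi (hG : DifferentiableOn ℂ G {z | 0 < z.im})
    (hS : S.Finite) (hK : Integrable K) (hδ : 0 < δ) (hδH : δ ≤ H)
    (hb : ∀ x y : ℝ, x ∉ S → δ ≤ y → ‖G (x + y * Complex.I)‖ ≤ K x) {a b : ℝ} (hab : a ≤ b) :
    ∫ x : ℝ in Iio a ∪ Ioi b, G (x + δ * Complex.I) =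
      (∫ x : ℝ in Iio a ∪ Ioi b, G (x + H * Complex.I)) -
        ((Complex.I * ∫ y in δ..H, G (a + y * Complex.I)) -
          Complex.I * ∫ y in δ..H, G (b + y * Complex.I)) := by
  have h₁ := integrable_horizontal hG.continuousOn hS hK hδ fun x hx => hb x δ hx le_rfl
  have h₂ := integrable_horizontal hG.continuousOn hS hK (hδ.trans_le hδH)
    fun x hx => hb x H hx hδH
  have h₃ := integrable_vertical_integral hG hS hK hδ hδH hb
  have hd := hasDerivAt_vertical_integral hG hδ (hδ.trans_le hδH)
  have hdisj : Disjoint (Iio a) (Ioi b) :=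
    disjoint_left.2 fun x hx hx' => absurd (hab.trans_lt hx') (not_lt.2 (le_of_lt hx))
  have e₁ := integral_Iic_of_hasDerivAt_of_tendsto' (a := a) (fun x _ => hd x)
    (h₂.sub h₁).integrableOn (tendsto_zero_of_hasDerivAt_of_integrableOn_Iic (a := a)
      (fun x _ => hd x) (h₂.sub h₁).integrableOn h₃.integrableOn)
  have e₂ := integral_Ioi_of_hasDerivAt_of_tendsto' (a := b) (fun x _ => hd x)
    (h₂.sub h₁).integrableOn (tendsto_zero_of_hasDerivAt_of_integrableOn_Ioi (a := b)
      (fun x _ => hd x) (h₂.sub h₁).integrableOn h₃.integrableOn)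
  rw [integral_Iic_eq_integral_Iio] at e₁
  have e₃ := setIntegral_union hdisj measurableSet_Ioi (h₂.sub h₁).integrableOn
    (h₂.sub h₁).integrableOn
  have e₄ := integral_sub (μ := volume.restrict (Iio a ∪ Ioi b)) h₂.integrableOn h₁.integrableOn
  simp only [Pi.sub_apply] at e₁ e₂ e₃
  linear_combination e₄ - e₃ - e₁ - e₂

end Strip

/-! ### The quotient `F z / (z - x₀)` -/

/-- Comparison of the Cauchy kernel with the weight `1 / (1 + |x|)`. -/
theorem one_add_abs_le_mul_of_le {x x₀ r c : ℝ} (hc : 0 < c) (hcr : c ≤ r) (hr : |x - x₀| ≤ r) :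
    1 + |x| ≤ (1 + (1 + |x₀|) / c) * r := by
  have h1 : |x| ≤ |x - x₀| + |x₀| := by simpa using abs_add_le (x - x₀) x₀
  have h2 : 1 + |x₀| ≤ (1 + |x₀|) / c * r := by
    rw [div_mul_eq_mul_div, le_div_iff₀ hc]
    gcongr
  linarith

namespace IsDominatedHolomorphic

variable {F : ℂ → ℂ} {f : ℝ → ℂ} {M : ℝ → ℝ} {S : Set ℝ}

theorem nonneg (h : IsDominatedHolomorphic F f M S) {x : ℝ} (hx : x ∉ S) : 0 ≤ M x :=
  (norm_nonneg _).trans (h.bound x 1 hx one_pos)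

theorem tendsto_vertical (h : IsDominatedHolomorphic F f M S) {x : ℝ} (hx : x ∉ S) :
    Tendsto (fun y : ℝ => F (x + y * Complex.I)) (𝓝[>] 0) (𝓝 (f x)) := by
  refine (h.trace x hx).comp (tendsto_nhdsWithin_iff.2 ⟨?_, ?_⟩)
  · have : Continuous fun y : ℝ => (x + y * Complex.I : ℂ) := by fun_prop
    simpa using (this.tendsto 0).mono_left nhdsWithin_le_nhds
  · filter_upwards [self_mem_nhdsWithin] with y hy
    simpa using hy

theorem norm_boundary_le (h : IsDominatedHolomorphic F f M S) {x : ℝ} (hx : x ∉ S) :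
    ‖f x‖ ≤ M x := by
  refine le_of_tendsto (h.tendsto_vertical hx).norm ?_
  filter_upwards [self_mem_nhdsWithin] with y hy using h.bound x y hx hy

theorem aestronglyMeasurable_boundary (h : IsDominatedHolomorphic F f M S) :
    AEStronglyMeasurable f := by
  refine aestronglyMeasurable_of_tendsto_ae atTop
    (f := fun (n : ℕ) (x : ℝ) => F (x + (1 / ((n : ℝ) + 1) : ℝ) * Complex.I)) (fun n => ?_) ?_
  · exact (continuous_horizontal h.differentiableOn.continuousOn
      Nat.one_div_pos_of_nat).aestronglyMeasurable
  · filter_upwards [ae_notMem_of_finite h.finite] with x hx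
    exact (h.tendsto_vertical hx).comp (tendsto_nhdsWithin_iff.2
      ⟨tendsto_one_div_add_atTop_nhds_zero_nat, .of_forall fun n =>
        mem_Ioi.2 Nat.one_div_pos_of_nat⟩)

/-- A value of size at most `M x`, divided by the Cauchy kernel's denominator `k` of modulus `r`, is
dominated by the integrable weight; this serves both inside the half-plane and on its boundary. -/
theorem norm_div_le {x x₀ r c : ℝ} (h : IsDominatedHolomorphic F f M S) (hx : x ∉ S) {w k : ℂ}
    (hw : ‖w‖ ≤ M x) (hk : ‖k‖ = r) (hc : 0 < c) (hcr : c ≤ r) (hr : |x - x₀| ≤ r) :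
    ‖w / k‖ ≤ (1 + (1 + |x₀|) / c) * (M x / (1 + |x|)) := by
  have h1 := one_add_abs_le_mul_of_le hc hcr hr
  have h0 := h.nonneg hx
  have hx0 : 0 < 1 + |x| := by positivity
  rw [norm_div, hk, ← mul_div_assoc, div_le_div_iff₀ (hc.trans_le hcr) hx0]
  calc ‖w‖ * (1 + |x|) ≤ M x * ((1 + (1 + |x₀|) / c) * r) := by gcongr
    _ = _ := by ring

/-- The quotient `F z / (z - x₀)` is dominated on vertical lines by an integrable function as long
as the distance to `x₀` is bounded below. -/
theorem norm_cauchyQuotient_le (h : IsDominatedHolomorphic F f M S) {x x₀ y c : ℝ} (hx : x ∉ S)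
    (hy : 0 < y) (hc : 0 < c) (hcr : c ≤ |x - x₀| ∨ c ≤ y) :
    ‖F (x + y * Complex.I) / (x + y * Complex.I - x₀)‖ ≤
      (1 + (1 + |x₀|) / c) * (M x / (1 + |x|)) := by
  have h1 : |x - x₀| ≤ ‖(x + y * Complex.I - x₀ : ℂ)‖ := by
    simpa using Complex.abs_re_le_norm (x + y * Complex.I - x₀ : ℂ)
  have h2 : y ≤ ‖(x + y * Complex.I - x₀ : ℂ)‖ := by
    simpa [abs_of_pos hy] using Complex.abs_im_le_norm (x + y * Complex.I - x₀ : ℂ)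
  exact h.norm_div_le hx (h.bound x y hx hy) rfl hc
    (hcr.elim (fun h => h.trans h1) fun h => h.trans h2) h1

theorem differentiableOn_cauchyQuotient (h : IsDominatedHolomorphic F f M S) (x₀ : ℝ) :
    DifferentiableOn ℂ (fun z => F z / (z - x₀)) {z | 0 < z.im} := by
  refine h.differentiableOn.div (by fun_prop) fun z hz h0 => ?_
  rw [sub_eq_zero] at h0
  simp [h0] at hz

/-- Cauchy's theorem on a horizontal line: the contribution at infinity vanishes. -/
theorem integral_cauchyQuotient_eq_zero (h : IsDominatedHolomorphic F f M S) (x₀ : ℝ) {δ : ℝ}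
    (hδ : 0 < δ) :
    ∫ x : ℝ, F (x + δ * Complex.I) / (x + δ * Complex.I - x₀) = 0 := by
  have hG := h.differentiableOn_cauchyQuotient x₀
  have hK : Integrable fun x => (1 + (1 + |x₀|) / δ) * (M x / (1 + |x|)) :=
    h.integrable.const_mul _
  have hlim : Tendsto (fun H : ℝ => ∫ x : ℝ, F (x + H * Complex.I) / (x + H * Complex.I - x₀))
      atTop (𝓝 (∫ x : ℝ, (0 : ℂ))) := by
    refine tendsto_integral_filter_of_dominated_convergence _ ?_ ?_ hK ?_
    · filter_upwards [eventually_gt_atTop 0] with H hH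
      exact (continuous_horizontal hG.continuousOn hH).aestronglyMeasurable
    · filter_upwards [eventually_ge_atTop δ] with H hH
      filter_upwards [ae_notMem_of_finite h.finite] with x hx
      exact h.norm_cauchyQuotient_le hx (hδ.trans_le hH) hδ (Or.inr hH)
    · filter_upwards [ae_notMem_of_finite h.finite] with x hx
      have hz : Tendsto (fun H : ℝ => M x / H) atTop (𝓝 0) :=
        tendsto_const_nhds.div_atTop tendsto_id
      refine squeeze_zero_norm' ?_ hz
      filter_upwards [eventually_gt_atTop 0] with H hH
      have h2 : H ≤ ‖(x + H * Complex.I - x₀ : ℂ)‖ := by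
        simpa [abs_of_pos hH] using Complex.abs_im_le_norm (x + H * Complex.I - x₀ : ℂ)
      rw [norm_div]
      exact div_le_div₀ (h.nonneg hx) (h.bound x H hx hH) hH h2
  rw [integral_zero] at hlim
  refine tendsto_nhds_unique (tendsto_const_nhds.congr' ?_) hlim
  filter_upwards [eventually_ge_atTop δ] with H hH
  exact (integral_horizontal_eq hG h.finite hK hδ hH fun x y hx hy =>
    h.norm_cauchyQuotient_le hx (hδ.trans_le hy) hδ (Or.inr hy)).symm

end IsDominatedHolomorphic

/-! ### The contour around a boundary point -/

theorem setOf_lt_abs_sub_eq (x₀ ε : ℝ) :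
    {ξ : ℝ | ε < |x₀ - ξ|} = Iio (x₀ - ε) ∪ Ioi (x₀ + ε) := by
  ext ξ
  simp only [mem_ofPred_eq, mem_union, mem_Iio, mem_Ioi, lt_abs]
  constructor <;> rintro (h | h) <;> [left; right; left; right] <;> linarith

theorem eventually_add_mul_notMem {S : Set ℝ} (hS : S.Finite) {x₀ : ℝ} (hx₀ : x₀ ∉ S) (c : ℝ) :
    ∀ᶠ ε in 𝓝[>] (0 : ℝ), x₀ + c * ε ∉ S := by
  have hc : Tendsto (fun ε : ℝ => x₀ + c * ε) (𝓝[>] 0) (𝓝 x₀) := by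
    have : Continuous fun ε : ℝ => x₀ + c * ε := by fun_prop
    simpa using (this.tendsto 0).mono_left nhdsWithin_le_nhds
  exact hc.eventually (hS.isClosed.isOpen_compl.mem_nhds hx₀)

theorem integral_inv_add_I :
    ∫ s in (-1 : ℝ)..1, (s + Complex.I : ℂ)⁻¹ = -(Real.pi / 2) * Complex.I := by
  have hne : ∀ s : ℝ, (s + Complex.I : ℂ) ≠ 0 := fun s h => by
    simpa using congrArg Complex.im h
  have hne' : ∀ s : ℝ, (((-s : ℝ) : ℂ) + Complex.I : ℂ) ≠ 0 := fun s => hne (-s)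
  have hc : Continuous fun s : ℝ => (s + Complex.I : ℂ)⁻¹ :=
    Continuous.inv₀ (by fun_prop) hne
  have hc' : Continuous fun s : ℝ => (((-s : ℝ) : ℂ) + Complex.I : ℂ)⁻¹ :=
    Continuous.inv₀ (by fun_prop) hne'
  -- averaging over `s ↦ -s` removes the odd real part of the integrand
  have h1 := intervalIntegral.integral_comp_neg (a := -1) (b := 1)
    (fun s : ℝ => (s + Complex.I : ℂ)⁻¹)
  rw [neg_neg] at h1
  have h2 := intervalIntegral.integral_add (hc.intervalIntegrable (μ := volume) (-1) 1)
    (hc'.intervalIntegrable (-1) 1)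
  have h3 : ∀ s : ℝ, (s + Complex.I : ℂ)⁻¹ + (((-s : ℝ) : ℂ) + Complex.I : ℂ)⁻¹ =
      (-2 * Complex.I) * (((1 + s ^ 2)⁻¹ : ℝ) : ℂ) := fun s => by
    have h4 : (1 + s ^ 2 : ℂ) ≠ 0 := by
      exact_mod_cast (by positivity : (0 : ℝ) < 1 + s ^ 2).ne'
    have := hne s
    have := hne' s
    push_cast at this ⊢
    field_simp
    linear_combination 2 * Complex.I * Complex.I_sq
  simp only [h3] at h2
  rw [intervalIntegral.integral_const_mul, intervalIntegral.integral_ofReal,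
    integral_inv_one_add_sq, h1] at h2
  rw [Real.arctan_neg, Real.arctan_one] at h2
  push_cast at h2
  linear_combination -h2 / 2

theorem integral_inv_sub_inv_one_add_mul_I :
    (∫ y in (0 : ℝ)..1, (-1 + y * Complex.I : ℂ)⁻¹) - ∫ y in (0 : ℝ)..1, (1 + y * Complex.I : ℂ)⁻¹ =
      -(Real.pi / 2) := by
  have hne : ∀ y : ℝ, (1 + y * Complex.I : ℂ) ≠ 0 := fun s h => by
    simpa using congrArg Complex.re h
  have hne' : ∀ y : ℝ, (-1 + y * Complex.I : ℂ) ≠ 0 := fun s h => by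
    simpa using congrArg Complex.re h
  have hc : Continuous fun s : ℝ => (1 + s * Complex.I : ℂ)⁻¹ :=
    Continuous.inv₀ (by fun_prop) hne
  have hc' : Continuous fun s : ℝ => (-1 + s * Complex.I : ℂ)⁻¹ :=
    Continuous.inv₀ (by fun_prop) hne'
  rw [← intervalIntegral.integral_sub (hc'.intervalIntegrable 0 1) (hc.intervalIntegrable 0 1)]
  have h3 : ∀ s : ℝ, (-1 + s * Complex.I : ℂ)⁻¹ - (1 + s * Complex.I : ℂ)⁻¹ =
      -2 * (((1 + s ^ 2)⁻¹ : ℝ) : ℂ) := fun s => by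
    have h4 : (1 + s ^ 2 : ℂ) ≠ 0 := by
      exact_mod_cast (by positivity : (0 : ℝ) < 1 + s ^ 2).ne'
    have := hne s
    have := hne' s
    push_cast
    field_simp
    linear_combination 2 * s ^ 2 * Complex.I_sq
  simp only [h3]
  rw [intervalIntegral.integral_const_mul, intervalIntegral.integral_ofReal,
    integral_inv_one_add_sq, Real.arctan_one, Real.arctan_zero]
  push_cast
  ring

/-- The upper side of the rectangle over `(x₀ - ε, x₀ + ε)`, rescaled to size one. -/
theorem integral_top_eq (F : ℂ → ℂ) (x₀ : ℝ) {ε : ℝ} (hε : 0 < ε) :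
    ∫ t in (x₀ - ε)..(x₀ + ε), F (t + ε * Complex.I) / (t + ε * Complex.I - x₀) =
      ∫ s in (-1 : ℝ)..1, F (x₀ + ε * (s + Complex.I)) / (s + Complex.I) := by
  have e := intervalIntegral.smul_integral_comp_add_mul (a := -1) (b := 1)
    (fun t : ℝ => F (t + ε * Complex.I) / (t + ε * Complex.I - x₀)) ε x₀
  rw [mul_neg, mul_one, ← sub_eq_add_neg] at e
  rw [← e, Complex.real_smul, ← intervalIntegral.integral_const_mul]
  refine intervalIntegral.integral_congr fun s _ => ?_
  have hε' : (ε : ℂ) ≠ 0 := by exact_mod_cast hε.ne'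
  have h1 : ((x₀ + ε * s : ℝ) : ℂ) + ε * Complex.I = x₀ + ε * (s + Complex.I) := by
    push_cast; ring
  simp only [h1, add_sub_cancel_left]
  rw [← mul_div_assoc, mul_div_mul_left _ _ hε']

/-- A vertical side (`c = ±1`) of the rectangle over `(x₀ - ε, x₀ + ε)`, rescaled to size one. -/
theorem integral_side_eq (F : ℂ → ℂ) (x₀ c : ℝ) {ε : ℝ} (hε : 0 < ε) :
    ∫ y in (0 : ℝ)..ε, F ((x₀ + c * ε : ℝ) + y * Complex.I) /
        ((x₀ + c * ε : ℝ) + y * Complex.I - x₀) =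
      ∫ s in (0 : ℝ)..1, F (x₀ + ε * (c + s * Complex.I)) / (c + s * Complex.I) := by
  have e := intervalIntegral.smul_integral_comp_add_mul (a := 0) (b := 1)
    (fun y : ℝ => F ((x₀ + c * ε : ℝ) + y * Complex.I) /
        ((x₀ + c * ε : ℝ) + y * Complex.I - x₀)) ε 0
  rw [mul_zero, mul_one, zero_add, zero_add] at e
  rw [← e, Complex.real_smul, ← intervalIntegral.integral_const_mul]
  refine intervalIntegral.integral_congr fun s _ => ?_
  have hε' : (ε : ℂ) ≠ 0 := by exact_mod_cast hε.ne'
  have h1 : ((x₀ + c * ε : ℝ) : ℂ) + (0 + ε * s : ℝ) * Complex.I =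
      x₀ + ε * (c + s * Complex.I) := by
    push_cast; ring
  simp only [h1, add_sub_cancel_left]
  rw [← mul_div_assoc, mul_div_mul_left _ _ hε']

namespace IsDominatedHolomorphic

variable {F : ℂ → ℂ} {f : ℝ → ℂ} {M : ℝ → ℝ} {S : Set ℝ}

theorem integrableOn_boundary_div (h : IsDominatedHolomorphic F f M S) (x₀ : ℝ) {ε : ℝ}
    (hε : 0 < ε) :
    IntegrableOn (fun t : ℝ => f t / (t - x₀)) {t | ε < |x₀ - t|} := by
  have hm : MeasurableSet {t | ε < |x₀ - t|} :=
    measurableSet_lt measurable_const (by fun_prop)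
  have hm2 : AEStronglyMeasurable (fun t : ℝ => f t / (t - x₀)) := by
    have := h.aestronglyMeasurable_boundary.aemeasurable
    exact (this.div (by fun_prop)).aestronglyMeasurable
  refine ((h.integrable.const_mul (1 + (1 + |x₀|) / ε)).integrableOn).mono' hm2.restrict ?_
  filter_upwards [ae_restrict_of_ae (ae_notMem_of_finite h.finite), ae_restrict_mem hm]
    with t ht ht2
  rw [abs_sub_comm] at ht2
  refine h.norm_div_le ht (h.norm_boundary_le ht) (r := |t - x₀|) ?_ hε ht2.le le_rfl
  rw [← Complex.ofReal_sub, Complex.norm_real, Real.norm_eq_abs]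

/-- The contour of integration is pushed down to the real line, except over `(x₀ - ε, x₀ + ε)`,
where it runs along the other three sides of a rectangle above the point `x₀`. -/
theorem integral_boundary_div_eq (h : IsDominatedHolomorphic F f M S) {x₀ ε : ℝ} (hε : 0 < ε)
    (ha : x₀ - ε ∉ S) (hb : x₀ + ε ∉ S) :
    ∫ t in {t | ε < |x₀ - t|}, f t / (t - x₀) =
      -(∫ t in (x₀ - ε)..(x₀ + ε), F (t + ε * Complex.I) / (t + ε * Complex.I - x₀)) -
        ((Complex.I * ∫ y in (0 : ℝ)..ε, F ((x₀ - ε : ℝ) + y * Complex.I) /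
            ((x₀ - ε : ℝ) + y * Complex.I - x₀)) -
          Complex.I * ∫ y in (0 : ℝ)..ε, F ((x₀ + ε : ℝ) + y * Complex.I) /
            ((x₀ + ε : ℝ) + y * Complex.I - x₀)) := by
  have hG := h.differentiableOn_cauchyQuotient x₀
  have hm : MeasurableSet {t | ε < |x₀ - t|} :=
    measurableSet_lt measurable_const (by fun_prop)
  -- the part of the line at height `ε` outside the window
  have hout : ∫ t : ℝ in {t | ε < |x₀ - t|}, F (t + ε * Complex.I) / (t + ε * Complex.I - x₀) =
      -∫ t in (x₀ - ε)..(x₀ + ε), F (t + ε * Complex.I) / (t + ε * Complex.I - x₀) := by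
    have hi := integrable_horizontal hG.continuousOn h.finite
      (h.integrable.const_mul (1 + (1 + |x₀|) / ε)) hε
      fun x hx => h.norm_cauchyQuotient_le hx hε hε (Or.inr le_rfl)
    have e := integral_add_compl hm hi
    rw [h.integral_cauchyQuotient_eq_zero x₀ hε] at e
    have hcompl : {t | ε < |x₀ - t|}ᶜ = Icc (x₀ - ε) (x₀ + ε) := by
      ext t
      simp only [mem_compl_iff, mem_ofPred_eq, not_lt, abs_le, mem_Icc]
      constructor <;> rintro ⟨_, _⟩ <;> constructor <;> linarith
    rw [hcompl, integral_Icc_eq_integral_Ioc,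
      ← intervalIntegral.integral_of_le (by linarith)] at e
    exact eq_neg_of_add_eq_zero_left e
  -- the vertical sides, starting at height `δ`, extend down to the real line
  have hside : ∀ a : ℝ, a ∉ S → ε ≤ |a - x₀| →
      Tendsto (fun δ : ℝ => ∫ y in δ..ε, F (a + y * Complex.I) / (a + y * Complex.I - x₀))
        (𝓝[>] 0) (𝓝 (∫ y in (0 : ℝ)..ε, F (a + y * Complex.I) / (a + y * Complex.I - x₀))) := by
    intro a ha haε
    have hint : IntegrableOn (fun y : ℝ => F (a + y * Complex.I) / (a + y * Complex.I - x₀))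
        (uIcc 0 ε) := by
      rw [uIcc_of_le hε.le, integrableOn_Icc_iff_integrableOn_Ioc]
      refine (integrable_const ((1 + (1 + |x₀|) / ε) * (M a / (1 + |a|)))).mono' ?_ ?_
      · exact ((continuousOn_vertical hG.continuousOn a).mono
          Ioc_subset_Ioi_self).aestronglyMeasurable measurableSet_Ioc
      · filter_upwards [ae_restrict_mem measurableSet_Ioc] with y hy
        exact h.norm_cauchyQuotient_le ha hy.1 hε (Or.inl haε)
    have hc := intervalIntegral.continuousOn_primitive_interval_left hint 0 left_mem_uIcc
    refine hc.tendsto.mono_left (nhdsWithin_le_of_mem ?_)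
    rw [uIcc_of_le hε.le]
    exact Icc_mem_nhdsGT hε
  -- dominated convergence on the rest of the line as its height `δ` tends to zero
  have hL : Tendsto (fun δ : ℝ => ∫ t in {t | ε < |x₀ - t|},
      F (t + δ * Complex.I) / (t + δ * Complex.I - x₀)) (𝓝[>] 0)
      (𝓝 (∫ t in {t | ε < |x₀ - t|}, f t / (t - x₀))) := by
    refine tendsto_integral_filter_of_dominated_convergence _ ?_ ?_
      (h.integrable.const_mul (1 + (1 + |x₀|) / ε)).integrableOn ?_
    · filter_upwards [self_mem_nhdsWithin] with δ hδ
      exact (continuous_horizontal hG.continuousOn hδ).aestronglyMeasurable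
    · filter_upwards [self_mem_nhdsWithin] with δ hδ
      filter_upwards [ae_restrict_of_ae (ae_notMem_of_finite h.finite), ae_restrict_mem hm]
        with t ht ht2
      rw [abs_sub_comm] at ht2
      exact h.norm_cauchyQuotient_le ht hδ hε (Or.inl ht2.le)
    · filter_upwards [ae_restrict_of_ae (ae_notMem_of_finite h.finite), ae_restrict_mem hm]
        with t ht ht2
      have hne : (t : ℂ) - x₀ ≠ 0 := by
        rw [← Complex.ofReal_sub, Complex.ofReal_ne_zero]
        intro h0
        rw [abs_sub_comm, h0, abs_zero] at ht2
        exact absurd ht2 (not_lt.2 hε.le)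
      refine (h.tendsto_vertical ht).div ?_ hne
      have : Continuous fun y : ℝ => (t + y * Complex.I - x₀ : ℂ) := by fun_prop
      simpa using (this.tendsto 0).mono_left nhdsWithin_le_nhds
  have hR := (tendsto_const_nhds (x := -∫ t in (x₀ - ε)..(x₀ + ε),
      F (t + ε * Complex.I) / (t + ε * Complex.I - x₀))).sub
    (((hside _ ha (by simp [abs_of_pos hε])).const_mul Complex.I).sub
      ((hside _ hb (by simp [abs_of_pos hε])).const_mul Complex.I))
  refine tendsto_nhds_unique (hL.congr' ?_) hR
  filter_upwards [Ioo_mem_nhdsGT hε] with δ hδ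
  rw [← hout, setOf_lt_abs_sub_eq]
  exact integral_horizontal_Iio_union_Ioi hG h.finite
    (h.integrable.const_mul (1 + (1 + |x₀|) / δ)) hδ.1 hδ.2.le
    (fun x y hx hy => h.norm_cauchyQuotient_le hx (hδ.1.trans_le hy) hδ.1 (Or.inr hy))
    (by linarith)

/-- Limit of the integral of `F z / (z - x₀)` along a path that shrinks to the boundary point
`x₀`. -/
theorem tendsto_integral_shrinking (h : IsDominatedHolomorphic F f M S) {x₀ : ℝ} (hx₀ : x₀ ∉ S)
    {u v : ℝ} (huv : u ≤ v) {p : ℝ → ℂ} (hp : Continuous p) (hp1 : ∀ s, 1 ≤ ‖p s‖)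
    (hp2 : ∀ s ∈ Ioc u v, ‖p s‖ ≤ 2) (hpi : ∀ s ∈ Ioc u v, 0 < (p s).im) :
    Tendsto (fun ε : ℝ => ∫ s in u..v, F (x₀ + ε * p s) / p s) (𝓝[>] 0)
      (𝓝 (f x₀ * ∫ s in u..v, (p s)⁻¹)) := by
  have hp0 : ∀ s, p s ≠ 0 := fun s h0 => by
    have := hp1 s
    rw [h0, norm_zero] at this
    linarith
  have hU : ∀ ε : ℝ, 0 < ε → ∀ s ∈ Ioc u v, 0 < (x₀ + ε * p s : ℂ).im := fun ε hε s hs => by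
    simpa using mul_pos hε (hpi s hs)
  rw [← intervalIntegral.integral_const_mul]
  refine intervalIntegral.tendsto_integral_filter_of_dominated_convergence
    (fun _ => ‖f x₀‖ + 1) ?_ ?_ intervalIntegrable_const ?_
  · filter_upwards [self_mem_nhdsWithin] with ε hε
    rw [uIoc_of_le huv]
    refine (ContinuousOn.div ?_ hp.continuousOn fun s _ => hp0 s).aestronglyMeasurable
      measurableSet_Ioc
    exact h.differentiableOn.continuousOn.comp (by fun_prop) fun s hs => hU ε hε s hs
  · have hev := (h.trace x₀ hx₀).norm.eventually (gt_mem_nhds (lt_add_one ‖f x₀‖))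
    obtain ⟨η, hη, hball⟩ := Metric.mem_nhdsWithin_iff.1 hev
    filter_upwards [Ioo_mem_nhdsGT (half_pos hη)] with ε hε
    refine .of_forall fun s hs => ?_
    rw [uIoc_of_le huv] at hs
    have hlt : ‖F (x₀ + ε * p s)‖ < ‖f x₀‖ + 1 := by
      refine hball ⟨?_, hU ε hε.1 s hs⟩
      rw [Metric.mem_ball, dist_eq_norm, add_sub_cancel_left, norm_mul, Complex.norm_real,
        Real.norm_eq_abs, abs_of_pos hε.1]
      calc ε * ‖p s‖ ≤ ε * 2 := mul_le_mul_of_nonneg_left (hp2 s hs) hε.1.le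
        _ < η := by linarith [hε.2]
    rw [norm_div]
    exact (div_le_self (norm_nonneg _) (hp1 s)).trans hlt.le
  · refine .of_forall fun s hs => ?_
    rw [uIoc_of_le huv] at hs
    rw [← div_eq_mul_inv]
    refine Tendsto.div_const ((h.trace x₀ hx₀).comp (tendsto_nhdsWithin_iff.2 ⟨?_, ?_⟩)) _
    · have : Continuous fun ε : ℝ => (x₀ + ε * p s : ℂ) := by fun_prop
      simpa using (this.tendsto 0).mono_left nhdsWithin_le_nhds
    · filter_upwards [self_mem_nhdsWithin] with ε hε using hU ε hε s hs

/-- The boundary values of a dominated holomorphic function reproduce themselves under the Cauchy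
principal value integral: the three sides of the small rectangle contribute half of the residue
`2πi f(x₀)`. -/
theorem tendsto_integral_boundary_div (h : IsDominatedHolomorphic F f M S) {x₀ : ℝ}
    (hx₀ : x₀ ∉ S) :
    Tendsto (fun ε : ℝ => ∫ t in {t | ε < |x₀ - t|}, f t / (t - x₀)) (𝓝[>] 0)
      (𝓝 (Real.pi * Complex.I * f x₀)) := by
  have hre : ∀ z : ℂ, 1 ≤ |z.re| → 1 ≤ ‖z‖ := fun z hz => hz.trans (Complex.abs_re_le_norm z)
  have him : ∀ z : ℂ, 1 ≤ |z.im| → 1 ≤ ‖z‖ := fun z hz => hz.trans (Complex.abs_im_le_norm z)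
  have hle : ∀ z : ℂ, |z.re| ≤ 1 → |z.im| ≤ 1 → ‖z‖ ≤ 2 := fun z h1 h2 =>
    (Complex.norm_le_abs_re_add_abs_im z).trans (by linarith)
  have t₁ := h.tendsto_integral_shrinking hx₀ (u := -1) (v := 1) (by norm_num)
    (p := fun s => s + Complex.I) (by fun_prop) (fun s => him _ (by simp))
    (fun s hs => hle _ (by simpa [abs_le] using ⟨hs.1.le, hs.2⟩) (by simp)) (by simp)
  have t₂ := h.tendsto_integral_shrinking hx₀ (u := 0) (v := 1) zero_le_one
    (p := fun s => ((-1 : ℝ) : ℂ) + s * Complex.I) (by fun_prop) (fun s => hre _ (by simp))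
    (fun s hs => hle _ (by simp) (by simpa [abs_of_pos hs.1] using hs.2))
    (fun s hs => by simpa using hs.1)
  have t₃ := h.tendsto_integral_shrinking hx₀ (u := 0) (v := 1) zero_le_one
    (p := fun s => ((1 : ℝ) : ℂ) + s * Complex.I) (by fun_prop) (fun s => hre _ (by simp))
    (fun s hs => hle _ (by simp) (by simpa [abs_of_pos hs.1] using hs.2))
    (fun s hs => by simpa using hs.1)
  have t := t₁.neg.sub ((t₂.const_mul Complex.I).sub (t₃.const_mul Complex.I))
  have hval : Real.pi * Complex.I * f x₀ =
      -(f x₀ * ∫ s in (-1 : ℝ)..1, (s + Complex.I : ℂ)⁻¹) -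
        (Complex.I * (f x₀ * ∫ s in (0 : ℝ)..1, (((-1 : ℝ) : ℂ) + s * Complex.I)⁻¹) -
          Complex.I * (f x₀ * ∫ s in (0 : ℝ)..1, (((1 : ℝ) : ℂ) + s * Complex.I)⁻¹)) := by
    have e := integral_inv_sub_inv_one_add_mul_I
    rw [integral_inv_add_I]
    push_cast
    linear_combination (Complex.I * f x₀) * e
  rw [hval]
  refine t.congr' ?_
  filter_upwards [self_mem_nhdsWithin, eventually_add_mul_notMem h.finite hx₀ (-1),
    eventually_add_mul_notMem h.finite hx₀ 1] with ε hε ha hb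
  have h₂ := integral_side_eq F x₀ (-1) hε
  have h₃ := integral_side_eq F x₀ 1 hε
  rw [neg_one_mul, ← sub_eq_add_neg] at h₂ ha
  rw [one_mul] at h₃ hb
  rw [h.integral_boundary_div_eq hε ha hb, integral_top_eq F x₀ hε, h₂, h₃]

end IsDominatedHolomorphic

/-! ### Boundary values of harmonic functions -/

/-- `v` is harmonic in the upper half-plane; off the finite set `S` of the real line `v`,
`∂v/∂x₁` and `∂v/∂x₂` have the boundary values `w`, `a` and `b`; and the partial derivatives are
dominated on vertical lines by `M`, which is integrable with respect to `dx / (1 + |x|)`. -/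
structure IsDominatedHarmonic (v : ℝ × ℝ → ℝ) (w a b M : ℝ → ℝ) (S : Set ℝ) : Prop where
  contDiffOn : ContDiffOn ℝ 2 v upperHalf
  laplace : ∀ x y : ℝ, 0 < y → deriv (fun t => deriv (fun s => v (s, y)) t) x +
    deriv (fun t => deriv (fun s => v (x, s)) t) y = 0
  finite : S.Finite
  integrable : Integrable fun x => M x / (1 + |x|)
  trace : ∀ x, x ∉ S → Tendsto v (𝓝[upperHalf] (x, 0)) (𝓝 (w x))
  trace_fst : ∀ x, x ∉ S →
    Tendsto (fun z : ℝ × ℝ => deriv (fun t => v (t, z.2)) z.1) (𝓝[upperHalf] (x, 0)) (𝓝 (a x))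
  trace_snd : ∀ x, x ∉ S →
    Tendsto (fun z : ℝ × ℝ => deriv (fun t => v (z.1, t)) z.2) (𝓝[upperHalf] (x, 0)) (𝓝 (b x))
  bound : ∀ x y : ℝ, x ∉ S → 0 < y →
    |deriv (fun t => v (t, y)) x| ≤ M x ∧ |deriv (fun t => v (x, t)) y| ≤ M x

theorem isOpen_upperHalf : IsOpen upperHalf := isOpen_lt continuous_const continuous_snd

theorem hasDerivAt_re {g : ℂ → ℝ} {x y : ℝ} (hg : DifferentiableAt ℝ g ⟨x, y⟩) :
    HasDerivAt (fun t : ℝ => g ⟨t, y⟩) (fderiv ℝ g ⟨x, y⟩ 1) x := by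
  refine HasFDerivAt.comp_hasDerivAt (f := fun t : ℝ => (⟨t, y⟩ : ℂ)) x hg.hasFDerivAt ?_
  simpa [Complex.mk_eq_add_mul_I] using
    (Complex.ofRealCLM.hasDerivAt (x := x)).add_const ((y : ℂ) * Complex.I)

theorem hasDerivAt_im {g : ℂ → ℝ} {x y : ℝ} (hg : DifferentiableAt ℝ g ⟨x, y⟩) :
    HasDerivAt (fun t : ℝ => g ⟨x, t⟩) (fderiv ℝ g ⟨x, y⟩ Complex.I) y := by
  refine HasFDerivAt.comp_hasDerivAt (f := fun t : ℝ => (⟨x, t⟩ : ℂ)) y hg.hasFDerivAt ?_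
  simpa [Complex.mk_eq_add_mul_I] using
    ((Complex.ofRealCLM.hasDerivAt (x := y)).mul_const Complex.I).const_add (x : ℂ)

theorem tendsto_complex (x : ℝ) :
    Tendsto (fun z : ℂ => (z.re, z.im)) (𝓝[{z | 0 < z.im}] (x : ℂ)) (𝓝[upperHalf] (x, 0)) := by
  refine tendsto_nhdsWithin_iff.2 ⟨?_, ?_⟩
  · have : Continuous fun z : ℂ => (z.re, z.im) := by fun_prop
    simpa using (this.tendsto (x : ℂ)).mono_left nhdsWithin_le_nhds
  · filter_upwards [self_mem_nhdsWithin] with z hz using hz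

theorem ofReal_re_div (a b x₀ t : ℝ) :
    ((a - Complex.I * b : ℂ) / (t - x₀)).re = -(a / (x₀ - t)) := by
  rw [← Complex.ofReal_sub, Complex.div_ofReal_re, ← neg_sub x₀ t, div_neg]
  simp

namespace IsDominatedHarmonic

variable {v : ℝ × ℝ → ℝ} {w a b M : ℝ → ℝ} {S : Set ℝ}

theorem contDiffAt_complex (h : IsDominatedHarmonic v w a b M S) {z : ℂ} (hz : 0 < z.im) :
    ContDiffAt ℝ 2 (fun z : ℂ => v (z.re, z.im)) z := by
  have h1 : ContDiffAt ℝ 2 v (z.re, z.im) :=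
    h.contDiffOn.contDiffAt (isOpen_upperHalf.mem_nhds hz)
  exact h1.comp z Complex.equivRealProdCLM.contDiff.contDiffAt

theorem deriv_fst_eq (h : IsDominatedHarmonic v w a b M S) {x y : ℝ} (hy : 0 < y) :
    deriv (fun t => v (t, y)) x = fderiv ℝ (fun z : ℂ => v (z.re, z.im)) ⟨x, y⟩ 1 :=
  (hasDerivAt_re ((h.contDiffAt_complex (z := ⟨x, y⟩) hy).differentiableAt two_ne_zero)).deriv

theorem deriv_snd_eq (h : IsDominatedHarmonic v w a b M S) {x y : ℝ} (hy : 0 < y) :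
    deriv (fun t => v (x, t)) y = fderiv ℝ (fun z : ℂ => v (z.re, z.im)) ⟨x, y⟩ Complex.I :=
  (hasDerivAt_im ((h.contDiffAt_complex (z := ⟨x, y⟩) hy).differentiableAt two_ne_zero)).deriv

theorem harmonicAt (h : IsDominatedHarmonic v w a b M S) {z : ℂ} (hz : 0 < z.im) :
    InnerProductSpace.HarmonicAt (fun z : ℂ => v (z.re, z.im)) z := by
  refine ⟨h.contDiffAt_complex hz, ?_⟩
  have hopen : {z : ℂ | 0 < z.im} ∈ 𝓝 z :=
    (isOpen_lt continuous_const Complex.continuous_im).mem_nhds hz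
  filter_upwards [hopen] with ζ hζ
  rcases ζ with ⟨x, y⟩
  have hy : 0 < y := hζ
  have hd : DifferentiableAt ℝ (fderiv ℝ fun z : ℂ => v (z.re, z.im)) ⟨x, y⟩ :=
    ((h.contDiffAt_complex hζ).fderiv_right (m := 1) (by norm_num)).differentiableAt one_ne_zero
  have e₁ := (hasDerivAt_re (hd.clm_apply (differentiableAt_const (1 : ℂ)))).deriv
  have e₂ := (hasDerivAt_im (hd.clm_apply (differentiableAt_const Complex.I))).deriv
  rw [fderiv_clm_apply hd (differentiableAt_const _)] at e₁ e₂
  have e := h.laplace x y hy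
  have e₃ : (fun t => deriv (fun s => v (s, y)) t) =
      fun t => fderiv ℝ (fun z : ℂ => v (z.re, z.im)) ⟨t, y⟩ 1 :=
    funext fun t => h.deriv_fst_eq hy
  have e₄ : (fun t => deriv (fun s => v (x, s)) t) =ᶠ[𝓝 y]
      fun t => fderiv ℝ (fun z : ℂ => v (z.re, z.im)) ⟨x, t⟩ Complex.I := by
    filter_upwards [lt_mem_nhds hy] with t ht using h.deriv_snd_eq ht
  rw [e₃, e₄.deriv_eq, e₁, e₂] at e
  simpa [InnerProductSpace.laplacian_eq_iteratedFDeriv_complexPlane,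
    iteratedFDeriv_two_apply] using e

/-- The complex gradient `∂v/∂x₁ - i ∂v/∂x₂` of a harmonic function is holomorphic. -/
theorem isDominatedHolomorphic (h : IsDominatedHarmonic v w a b M S) :
    IsDominatedHolomorphic
      (fun z => ((deriv (fun t => v (t, z.im)) z.re : ℝ) : ℂ) -
        Complex.I * ((deriv (fun t => v (z.re, t)) z.im : ℝ) : ℂ))
      (fun x => (a x : ℂ) - Complex.I * (b x : ℂ)) (fun x => 2 * M x) S where
  differentiableOn := by
    have hd : DifferentiableOn ℂ (fun z : ℂ =>
        (fderiv ℝ (fun z : ℂ => v (z.re, z.im)) z 1 : ℂ) -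
          Complex.I * (fderiv ℝ (fun z : ℂ => v (z.re, z.im)) z Complex.I : ℂ))
        {z | 0 < z.im} := fun z hz =>
      (HarmonicAt.differentiableAt_complex_partial (h.harmonicAt hz)).differentiableWithinAt
    refine hd.congr fun z hz => ?_
    rw [h.deriv_fst_eq hz, h.deriv_snd_eq hz]
  finite := h.finite
  integrable := by simpa only [mul_div_assoc] using h.integrable.const_mul 2
  bound x y hx hy := by
    have hb := h.bound x y hx hy
    refine (norm_sub_le _ _).trans ?_
    simp only [norm_mul, Complex.norm_I, one_mul, Complex.norm_real, Real.norm_eq_abs]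
    simp only [Complex.add_re, Complex.ofReal_re, Complex.mul_re, Complex.I_re, mul_zero,
      Complex.ofReal_im, Complex.I_im, mul_one, sub_self, add_zero, Complex.add_im,
      Complex.mul_im, zero_add]
    linarith [hb.1, hb.2]
  trace x hx := by
    have h1 := (h.trace_fst x hx).comp (tendsto_complex x)
    have h2 := (h.trace_snd x hx).comp (tendsto_complex x)
    exact ((Complex.continuous_ofReal.tendsto _).comp h1).sub
      (((Complex.continuous_ofReal.tendsto _).comp h2).const_mul Complex.I)

theorem integrableOn_div (h : IsDominatedHarmonic v w a b M S) (x₀ : ℝ) {ε : ℝ} (hε : 0 < ε) :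
    IntegrableOn (fun ξ => a ξ / (x₀ - ξ)) {ξ | ε < |x₀ - ξ|} := by
  have h1 := (h.isDominatedHolomorphic.integrableOn_boundary_div x₀ hε).re.neg
  refine h1.congr (.of_forall fun t => ?_)
  simp only [Pi.neg_apply, RCLike.re_to_complex, ofReal_re_div, neg_neg]

/-- On the boundary, the normal derivative of a harmonic function is minus the Cauchy singular
operator applied to the tangential one. -/
theorem tendsto_truncatedCauchy (h : IsDominatedHarmonic v w a b M S) {x₀ : ℝ} (hx₀ : x₀ ∉ S) :
    Tendsto (truncatedCauchy a x₀) (𝓝[>] 0) (𝓝 (-b x₀)) := by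
  have h1 := h.isDominatedHolomorphic.tendsto_integral_boundary_div hx₀
  have h2 := (((Complex.continuous_re.tendsto _).comp h1).neg).const_mul (1 / Real.pi)
  have h3 : 1 / Real.pi * -(Real.pi * Complex.I * (a x₀ - Complex.I * b x₀) : ℂ).re = -b x₀ := by
    have h4 : (Real.pi * Complex.I * (a x₀ - Complex.I * b x₀) : ℂ).re = Real.pi * b x₀ := by
      simp [Complex.mul_re, Complex.mul_im]
    rw [h4]
    field_simp
  rw [h3] at h2
  refine h2.congr' ?_
  filter_upwards [self_mem_nhdsWithin] with ε hε
  have h5 := integral_re (h.isDominatedHolomorphic.integrableOn_boundary_div x₀ hε)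
  simp only [RCLike.re_to_complex, ofReal_re_div, integral_neg] at h5
  simp only [truncatedCauchy, Function.comp_apply]
  rw [← h5, neg_neg]

/-- The boundary values of `v` are differentiable, and the derivative is the boundary value of
`∂v/∂x₁`: this is the mean value inequality on horizontal lines near the boundary. -/
theorem hasDerivAt_trace (h : IsDominatedHarmonic v w a b M S) {x : ℝ} (hx : x ∉ S) :
    HasDerivAt w (a x) x := by
  rw [hasDerivAt_iff_isLittleO, Asymptotics.isLittleO_iff]
  intro c hc
  obtain ⟨r, hr, hball⟩ := Metric.mem_nhdsWithin_iff.1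
    ((h.trace_fst x hx).eventually (Metric.closedBall_mem_nhds (a x) hc))
  have hS : Sᶜ ∈ 𝓝 x := h.finite.isClosed.isOpen_compl.mem_nhds hx
  filter_upwards [hS, Metric.ball_mem_nhds x hr] with x' hx' hxr
  have hvert : ∀ x₁ : ℝ, Tendsto (fun y : ℝ => (x₁, y)) (𝓝[>] 0) (𝓝[upperHalf] (x₁, 0)) := by
    intro x₁
    refine tendsto_nhdsWithin_iff.2 ⟨?_, ?_⟩
    · exact ((by fun_prop : Continuous fun y : ℝ => (x₁, y)).tendsto 0).mono_left nhdsWithin_le_nhds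
    · filter_upwards [self_mem_nhdsWithin] with y hy using hy
  have hlim := ((((h.trace x' hx').comp (hvert x')).sub ((h.trace x hx).comp (hvert x))).sub
    (tendsto_const_nhds (x := (x' - x) • a x))).norm
  refine le_of_tendsto hlim ?_
  filter_upwards [Ioo_mem_nhdsGT hr] with y hy
  have hderiv : ∀ t ∈ Metric.ball x r, HasDerivWithinAt (fun t => v (t, y) - t * a x)
      (deriv (fun t => v (t, y)) t - a x) (Metric.ball x r) t := by
    intro t _
    have hd := hasDerivAt_re
      ((h.contDiffAt_complex (z := ⟨t, y⟩) hy.1).differentiableAt two_ne_zero)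
    have hd' : HasDerivAt (fun t => v (t, y)) (deriv (fun t => v (t, y)) t) t :=
      hd.differentiableAt.hasDerivAt
    simpa only [one_mul] using!
      (hd'.sub ((hasDerivAt_id t).mul_const (a x))).hasDerivWithinAt (s := Metric.ball x r)
  have hbd : ∀ t ∈ Metric.ball x r, ‖deriv (fun t => v (t, y)) t - a x‖ ≤ c := by
    intro t ht
    have : (t, y) ∈ Metric.ball (x, (0 : ℝ)) r := by
      rw [← ball_prod_same]
      exact ⟨ht, by simpa [abs_of_pos hy.1] using hy.2⟩
    have := hball ⟨this, hy.1⟩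
    rwa [← dist_eq_norm]
  have := (convex_ball x r).norm_image_sub_le_of_norm_hasDerivWithin_le hderiv hbd
    (Metric.mem_ball_self hr) hxr
  refine le_of_eq_of_le (congrArg norm ?_) this
  rw [smul_eq_mul, Function.comp_apply, Function.comp_apply]
  ring

end IsDominatedHarmonic

/-! ### The two half-planes of a crack field -/

theorem tendsto_traceUp {g : ℝ × ℝ → ℝ} {x : ℝ} (h : HasTraces g x) :
    Tendsto g (𝓝[upperHalf] (x, 0)) (𝓝 (traceUp g x)) := tendsto_nhds_limUnder h.1

theorem tendsto_traceDown {g : ℝ × ℝ → ℝ} {x : ℝ} (h : HasTraces g x) :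
    Tendsto g (𝓝[lowerHalf] (x, 0)) (𝓝 (traceDown g x)) := tendsto_nhds_limUnder h.2

theorem tendsto_reflect (x : ℝ) :
    Tendsto (fun z : ℝ × ℝ => (z.1, -z.2)) (𝓝[upperHalf] (x, 0)) (𝓝[lowerHalf] (x, 0)) := by
  refine tendsto_nhdsWithin_iff.2 ⟨?_, ?_⟩
  · have : Continuous fun z : ℝ × ℝ => (z.1, -z.2) := by fun_prop
    simpa using (this.tendsto (x, 0)).mono_left nhdsWithin_le_nhds
  · filter_upwards [self_mem_nhdsWithin] with z hz
    exact neg_lt_zero.2 (show 0 < z.2 from hz)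

theorem minusPart_of_pos (g : ℝ → ℝ) {x : ℝ} (hx : 0 < x) : minusPart g x = 0 := by
  simp [minusPart, hx.le]

theorem projMinus_of_pos (g : ℝ → ℝ) {x : ℝ} (hx : 0 < x) : projMinus g x = 0 := by
  simp [projMinus, hx]

theorem stress13_of_pos (μp μm : ℝ) (u : ℝ × ℝ → ℝ) {x y : ℝ} (hy : 0 < y) :
    stress13 μp μm u (x, y) = μp * deriv (fun t => u (t, y)) x := by
  simp [stress13, shearModulus, hy]

theorem stress23_of_pos (μp μm : ℝ) (u : ℝ × ℝ → ℝ) {x y : ℝ} (hy : 0 < y) :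
    stress23 μp μm u (x, y) = μp * deriv (fun t => u (x, t)) y := by
  simp [stress23, shearModulus, hy]

theorem stress13_of_neg (μp μm : ℝ) (u : ℝ × ℝ → ℝ) {x y : ℝ} (hy : y < 0) :
    stress13 μp μm u (x, y) = μm * deriv (fun t => u (t, y)) x := by
  simp [stress13, shearModulus, hy.le.not_gt]

theorem stress23_of_neg (μp μm : ℝ) (u : ℝ × ℝ → ℝ) {x y : ℝ} (hy : y < 0) :
    stress23 μp μm u (x, y) = μm * deriv (fun t => u (x, t)) y := by
  simp [stress23, shearModulus, hy.le.not_gt]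

theorem abs_le_div_of_abs_mul_le {μ d m : ℝ} (hμ : 0 < μ) (h : |μ * d| ≤ m) : |d| ≤ m / μ := by
  rw [abs_mul, abs_of_pos hμ] at h
  rwa [le_div_iff₀' hμ]

namespace IsAntiplaneCrackField

variable {μp μm : ℝ} {pp pm : ℝ → ℝ} {E : Set ℝ} {u : ℝ × ℝ → ℝ} {M : ℝ → ℝ}

theorem isDominatedHarmonic_upper (hμp : 0 < μp) (hE : E.Finite)
    (hu : IsAntiplaneCrackField μp μm pp pm E u)
    (hM : Integrable fun x => M x / (1 + |x|))
    (hb : ∀ x y, x ≠ 0 → x ∉ E → y ≠ 0 →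
      |stress13 μp μm u (x, y)| ≤ M x ∧ |stress23 μp μm u (x, y)| ≤ M x) :
    IsDominatedHarmonic u (traceUp u) (fun x => traceUp (stress13 μp μm u) x / μp)
      (fun x => traceUp (stress23 μp μm u) x / μp) (fun x => M x / μp) (insert 0 E) where
  contDiffOn := hu.smooth.mono subset_union_left
  laplace x y hy := by
    have e := hu.equilibrium (x, y) (Or.inl hy)
    have e₁ : (fun t => stress13 μp μm u (t, y)) = fun t => μp * deriv (fun s => u (s, y)) t :=
      funext fun t => stress13_of_pos μp μm u hy
    have e₂ : (fun t => stress23 μp μm u (x, t)) =ᶠ[𝓝 y]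
        fun t => μp * deriv (fun s => u (x, s)) t := by
      filter_upwards [lt_mem_nhds hy] with t ht using stress23_of_pos μp μm u ht
    simp only [e₁, e₂.deriv_eq, deriv_const_mul_field, ← mul_add] at e
    exact (mul_eq_zero.1 e).resolve_left hμp.ne'
  finite := hE.insert 0
  integrable := by simpa only [div_right_comm] using hM.div_const μp
  trace x hx := by
    rw [mem_insert_iff, not_or] at hx
    exact tendsto_traceUp (hu.trace_displacement x hx.1 hx.2)
  trace_fst x hx := by
    rw [mem_insert_iff, not_or] at hx
    refine ((tendsto_traceUp (hu.trace_stress13 x hx.1 hx.2)).div_const μp).congr' ?_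
    filter_upwards [self_mem_nhdsWithin] with z hz
    rw [stress13_of_pos μp μm u (x := z.1) hz, mul_div_cancel_left₀ _ hμp.ne']
  trace_snd x hx := by
    rw [mem_insert_iff, not_or] at hx
    refine ((tendsto_traceUp (hu.trace_stress23 x hx.1 hx.2)).div_const μp).congr' ?_
    filter_upwards [self_mem_nhdsWithin] with z hz
    rw [stress23_of_pos μp μm u (x := z.1) hz, mul_div_cancel_left₀ _ hμp.ne']
  bound x y hx hy := by
    rw [mem_insert_iff, not_or] at hx
    have h := hb x y hx.1 hx.2 hy.ne'
    rw [stress13_of_pos μp μm u hy, stress23_of_pos μp μm u hy] at h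
    exact ⟨abs_le_div_of_abs_mul_le hμp h.1, abs_le_div_of_abs_mul_le hμp h.2⟩

/-- The field in the lower half-plane, reflected in the plane of the crack. The reflection changes
the sign of `∂u/∂x₂`. -/
theorem isDominatedHarmonic_lower (hμm : 0 < μm) (hE : E.Finite)
    (hu : IsAntiplaneCrackField μp μm pp pm E u)
    (hM : Integrable fun x => M x / (1 + |x|))
    (hb : ∀ x y, x ≠ 0 → x ∉ E → y ≠ 0 →
      |stress13 μp μm u (x, y)| ≤ M x ∧ |stress23 μp μm u (x, y)| ≤ M x) :
    IsDominatedHarmonic (fun z => u (z.1, -z.2)) (traceDown u)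
      (fun x => traceDown (stress13 μp μm u) x / μm)
      (fun x => -(traceDown (stress23 μp μm u) x / μm)) (fun x => M x / μm) (insert 0 E) where
  contDiffOn :=
    (hu.smooth.mono subset_union_right).comp (t := lowerHalf) (by fun_prop)
      fun z hz => show -z.2 < 0 from neg_lt_zero.2 hz
  laplace x y hy := by
    have hy' : -y < 0 := neg_lt_zero.2 hy
    have e := hu.equilibrium (x, -y) (Or.inr hy')
    have e₁ : (fun t => stress13 μp μm u (t, -y)) = fun t => μm * deriv (fun s => u (s, -y)) t :=
      funext fun t => stress13_of_neg μp μm u hy'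
    have e₂ : (fun t => stress23 μp μm u (x, t)) =ᶠ[𝓝 (-y)]
        fun t => μm * deriv (fun s => u (x, s)) t := by
      filter_upwards [gt_mem_nhds hy'] with t ht using stress23_of_neg μp μm u ht
    simp only [e₁, e₂.deriv_eq, deriv_const_mul_field, ← mul_add] at e
    have e₃ : (fun t => deriv (fun s => u (x, -s)) t) =
        fun t => -deriv (fun s => u (x, s)) (-t) :=
      funext fun t => deriv_comp_neg (fun s => u (x, s)) t
    rw [e₃, deriv.fun_neg, deriv_comp_neg (deriv fun s => u (x, s)) y, neg_neg]
    exact (mul_eq_zero.1 e).resolve_left hμm.ne'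
  finite := hE.insert 0
  integrable := by simpa only [div_right_comm] using hM.div_const μm
  trace x hx := by
    rw [mem_insert_iff, not_or] at hx
    exact (tendsto_traceDown (hu.trace_displacement x hx.1 hx.2)).comp (tendsto_reflect x)
  trace_fst x hx := by
    rw [mem_insert_iff, not_or] at hx
    refine (((tendsto_traceDown (hu.trace_stress13 x hx.1 hx.2)).comp
      (tendsto_reflect x)).div_const μm).congr' ?_
    filter_upwards [self_mem_nhdsWithin] with z hz
    rw [Function.comp_apply, stress13_of_neg μp μm u (neg_lt_zero.2 hz),
      mul_div_cancel_left₀ _ hμm.ne']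
  trace_snd x hx := by
    rw [mem_insert_iff, not_or] at hx
    refine (((tendsto_traceDown (hu.trace_stress23 x hx.1 hx.2)).comp
      (tendsto_reflect x)).div_const μm).neg.congr' ?_
    filter_upwards [self_mem_nhdsWithin] with z hz
    rw [Function.comp_apply, stress23_of_neg μp μm u (neg_lt_zero.2 hz),
      mul_div_cancel_left₀ _ hμm.ne', ← deriv_comp_neg (fun s => u (z.1, s)) z.2]
  bound x y hx hy := by
    rw [mem_insert_iff, not_or] at hx
    have hy' : -y < 0 := neg_lt_zero.2 hy
    have h := hb x (-y) hx.1 hx.2 hy'.ne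
    rw [stress13_of_neg μp μm u hy', stress23_of_neg μp μm u hy'] at h
    rw [deriv_comp_neg (fun s => u (x, s)) y, abs_neg]
    exact ⟨abs_le_div_of_abs_mul_le hμm h.1, abs_le_div_of_abs_mul_le hμm h.2⟩

end IsAntiplaneCrackField

/-! ### The jump across the crack -/

theorem truncatedCauchy_congr {φ ψ : ℝ → ℝ} (h : φ =ᵐ[volume] ψ) (x : ℝ) :
    truncatedCauchy φ x = truncatedCauchy ψ x := by
  funext ε
  unfold truncatedCauchy
  congr 1
  refine integral_congr_ae (ae_restrict_of_ae ?_)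
  filter_upwards [h] with ξ hξ
  rw [hξ]

/-- The Poisson ratios cancel. -/
theorem bConst_add_eConst (μp μm νp νm : ℝ) :
    bConst μp μm νp νm + eConst μp μm νp νm = 1 / μp + 1 / μm := by
  unfold bConst eConst
  ring

section Jump

variable {w₁ w₂ : ℝ → ℝ} {v₁ v₂ : ℝ × ℝ → ℝ} {a₁ a₂ b₁ b₂ M₁ M₂ : ℝ → ℝ} {S : Set ℝ}

/-- Since the jump `w₁ - w₂` vanishes ahead of the crack, cutting it off at the crack tip does not
change its derivative away from the tip. -/
theorem hasDerivAt_minusPart_sub (h₁ : IsDominatedHarmonic v₁ w₁ a₁ b₁ M₁ S)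
    (h₂ : IsDominatedHarmonic v₂ w₂ a₂ b₂ M₂ S) (hw : ∀ x, 0 < x → w₁ x - w₂ x = 0)
    {x : ℝ} (hx : x ∉ S) (hx0 : x ≠ 0) :
    HasDerivAt (minusPart fun x => w₁ x - w₂ x) (a₁ x - a₂ x) x := by
  refine ((h₁.hasDerivAt_trace hx).fun_sub (h₂.hasDerivAt_trace hx)).congr_of_eventuallyEq ?_
  rcases hx0.lt_or_gt with hneg | hpos
  · filter_upwards [gt_mem_nhds hneg] with t ht
    exact indicator_of_mem (mem_Iio.2 ht) _
  · filter_upwards [lt_mem_nhds hpos] with t ht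
    rw [hw t ht, minusPart_of_pos _ ht]

theorem deriv_minusPart_of_pos (g : ℝ → ℝ) {x : ℝ} (hx : 0 < x) : deriv (minusPart g) x = 0 := by
  have : minusPart g =ᶠ[𝓝 x] fun _ => 0 := by
    filter_upwards [lt_mem_nhds hx] with t ht using minusPart_of_pos g ht
  rw [this.deriv_eq, deriv_const]

theorem projMinus_deriv_minusPart_ae_eq (h₁ : IsDominatedHarmonic v₁ w₁ a₁ b₁ M₁ S)
    (h₂ : IsDominatedHarmonic v₂ w₂ a₂ b₂ M₂ S) (hw : ∀ x, 0 < x → w₁ x - w₂ x = 0) :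
    projMinus (deriv (minusPart fun x => w₁ x - w₂ x)) =ᵐ[volume] fun x => a₁ x - a₂ x := by
  filter_upwards [ae_notMem_of_finite (h₁.finite.insert 0)] with x hx
  rw [mem_insert_iff, not_or] at hx
  have hd := (hasDerivAt_minusPart_sub h₁ h₂ hw hx.2 hx.1).deriv
  rcases lt_or_gt_of_ne hx.1 with hneg | hpos
  · exact (indicator_of_mem (mem_Iic.2 hneg.le) _).trans hd
  · rw [← hd, deriv_minusPart_of_pos _ hpos, projMinus_of_pos _ hpos]

theorem integrableOn_projMinus_deriv (h₁ : IsDominatedHarmonic v₁ w₁ a₁ b₁ M₁ S)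
    (h₂ : IsDominatedHarmonic v₂ w₂ a₂ b₂ M₂ S) (hw : ∀ x, 0 < x → w₁ x - w₂ x = 0)
    (x : ℝ) {ε : ℝ} (hε : 0 < ε) :
    IntegrableOn (fun ξ => projMinus (deriv (minusPart fun x => w₁ x - w₂ x)) ξ / (x - ξ))
      {ξ | ε < |x - ξ|} := by
  refine ((h₁.integrableOn_div x hε).sub (h₂.integrableOn_div x hε)).congr
    (ae_restrict_of_ae ?_)
  filter_upwards [projMinus_deriv_minusPart_ae_eq h₁ h₂ hw] with ξ hξ
  rw [hξ, Pi.sub_apply, sub_div]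

/-- The Cauchy singular integral of the derivative of the jump, as a combination of the normal
derivatives `b₁`, `b₂` on the two sides. Both principal values exist separately. -/
theorem tendsto_truncatedCauchy_projMinus_deriv (h₁ : IsDominatedHarmonic v₁ w₁ a₁ b₁ M₁ S)
    (h₂ : IsDominatedHarmonic v₂ w₂ a₂ b₂ M₂ S) (hw : ∀ x, 0 < x → w₁ x - w₂ x = 0)
    {x : ℝ} (hx : x ∉ S) :
    Tendsto (truncatedCauchy (projMinus (deriv (minusPart fun x => w₁ x - w₂ x))) x) (𝓝[>] 0)
      (𝓝 (-b₁ x - -b₂ x)) := by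
  rw [truncatedCauchy_congr (projMinus_deriv_minusPart_ae_eq h₁ h₂ hw)]
  refine ((h₁.tendsto_truncatedCauchy hx).sub (h₂.tendsto_truncatedCauchy hx)).congr' ?_
  filter_upwards [self_mem_nhdsWithin] with ε hε
  simp only [truncatedCauchy, sub_div]
  rw [integral_sub (h₁.integrableOn_div x hε) (h₂.integrableOn_div x hε), mul_sub]

end Jump

end InterfacialCrack

open InterfacialCrack in
theorem mainTheorem3 (μp μm νp νm : ℝ) (hμp : 0 < μp) (hμm : 0 < μm)
    (pp pm : ℝ → ℝ) (E : Set ℝ) (hE : E.Finite) (hE0 : E ⊆ Set.Iio 0)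
    (u : ℝ × ℝ → ℝ) (hu : InterfacialCrack.IsAntiplaneCrackField μp μm pp pm E u) :
    (∀ x, x ≠ 0 → x ∉ E →
      DifferentiableAt ℝ (InterfacialCrack.minusPart (InterfacialCrack.jump u)) x) ∧
    (∀ x, x < 0 → x ∉ E →
      InterfacialCrack.CauchyPVExists
        (InterfacialCrack.projMinus
          (deriv (InterfacialCrack.minusPart (InterfacialCrack.jump u)))) x ∧
      (pp x + pm x) / 2 + InterfacialCrack.etaConst μp μm / 2 * (pp x - pm x) =
        -(InterfacialCrack.bConst μp μm νp νm + InterfacialCrack.eConst μp μm νp νm)⁻¹ *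
          InterfacialCrack.opS
            (deriv (InterfacialCrack.minusPart (InterfacialCrack.jump u))) x) ∧
    (∀ x, 0 < x →
      MeasureTheory.IntegrableOn
        (fun ξ => deriv (InterfacialCrack.minusPart (InterfacialCrack.jump u)) ξ / (x - ξ))
        (Set.Iio 0) ∧
      InterfacialCrack.CauchyPVExists
        (InterfacialCrack.projMinus
          (deriv (InterfacialCrack.minusPart (InterfacialCrack.jump u)))) x ∧
      InterfacialCrack.plusPart
          (InterfacialCrack.average (InterfacialCrack.stress23 μp μm u)) x =
        -(InterfacialCrack.bConst μp μm νp νm + InterfacialCrack.eConst μp μm νp νm)⁻¹ *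
          InterfacialCrack.opC
            (deriv (InterfacialCrack.minusPart (InterfacialCrack.jump u))) x) := by
  obtain ⟨M, hM, hb⟩ := hu.decay
  have h₁ := hu.isDominatedHarmonic_upper hμp hE hM hb
  have h₂ := hu.isDominatedHarmonic_lower hμm hE hM hb
  have hw : ∀ x, 0 < x → traceUp u x - traceDown u x = 0 := hu.contact_displacement
  have hint : ∀ (x : ℝ) {ε : ℝ}, 0 < ε →
      IntegrableOn (fun ξ => projMinus (deriv (minusPart (jump u))) ξ / (x - ξ))
        {ξ | ε < |x - ξ|} :=
    fun x _ hε => integrableOn_projMinus_deriv h₁ h₂ hw x hε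
  have hlim : ∀ x, x ≠ 0 → x ∉ E →
      Tendsto (truncatedCauchy (projMinus (deriv (minusPart (jump u)))) x) (𝓝[>] 0)
        (𝓝 (-(traceUp (stress23 μp μm u) x / μp + traceDown (stress23 μp μm u) x / μm))) := by
    intro x hx hxE
    have := tendsto_truncatedCauchy_projMinus_deriv h₁ h₂ hw (x := x) (by simp [hx, hxE])
    rwa [neg_neg, ← neg_add'] at this
  have hpv : ∀ x, x ≠ 0 → x ∉ E → CauchyPVExists (projMinus (deriv (minusPart (jump u)))) x :=
    fun x hx hxE => ⟨fun ε hε => hint x hε, _, hlim x hx hxE⟩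
  refine ⟨fun x hx hxE => ?_, fun x hx hxE => ⟨hpv x hx.ne hxE, ?_⟩, fun x hx => ?_⟩
  · exact (hasDerivAt_minusPart_sub h₁ h₂ hw (by simp [hx, hxE]) hx).differentiableAt
  · have e : opS (deriv (minusPart (jump u))) x = _ :=
      (indicator_of_mem (mem_Iic.2 hx.le) _).trans (hlim x hx.ne hxE).limUnder_eq
    rw [e, hu.load_up x hx hxE, hu.load_down x hx hxE, bConst_add_eConst, etaConst]
    field_simp
    ring
  · have hxE : x ∉ E := fun h => lt_asymm hx (hE0 h)
    refine ⟨?_, hpv x hx.ne' hxE, ?_⟩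
    -- the half-axis `ξ < 0` stays at distance more than `x / 2` from the pole
    · have hsub : Iio 0 ⊆ {ξ | x / 2 < |x - ξ|} := fun ξ hξ => by
        rw [mem_Iio] at hξ
        exact lt_of_lt_of_le (by linarith) (le_abs_self (x - ξ))
      refine ((hint x (half_pos hx)).mono_set hsub).congr_fun (fun ξ hξ => ?_) measurableSet_Iio
      exact congrArg (· / (x - ξ)) (indicator_of_mem (mem_Iic.2 (le_of_lt hξ)) _)
    · have e : opC (deriv (minusPart (jump u))) x = _ :=
        (indicator_of_mem (mem_Ici.2 hx.le) _).trans (hlim x hx.ne' hxE).limUnder_eq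
      have e' : plusPart (InterfacialCrack.average (stress23 μp μm u)) x = _ :=
        indicator_of_mem (mem_Ioi.2 hx) _
      have hj : traceUp (stress23 μp μm u) x - traceDown (stress23 μp μm u) x = 0 :=
        hu.contact_traction x hx
      rw [e, e', InterfacialCrack.average, sub_eq_zero.1 hj, bConst_add_eConst]
      field_simp
      ring
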